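/- Let $X$, $Y$, $W$ be metric spaces and let $\mathcal P$ be a family of continuous paths $p:[a,b]\to X$ (the compact interval $[a,b]$ may depend on $p$). Assume that: (i) $X$ is simply connected; (ii) $X$ is $\mathcal P$-connected: for each $p:[a,b]\to X$ in $\mathcal P$ the reverse path $\bar p(t)=p(a-t+b)$ is in $\mathcal P$, and any two points of $X$ are joined by a path in $\mathcal P$; (iii) $X$ is locally $\mathcal P$-contractible: every $x_0\in X$ has an open neighborhood $U$ with a continuous map $H:U\times[0,1]\to U$ such that $H(x_0,t)=x_0$ for all $t\in[0,1]$, $H(x,0)=x_0$ and $H(x,1)=x$ for all $x\in U$, and for every $x\in U$ the path $t\mapsto H(x,t)$, $t\in[0,1]$, belongs to $\mathcal P$. Let $f:X\times Y\to W$ be continuous, let $w\in W$, and put $Z_w=\{(x,y)\in X\times Y: f(x,y)=w\}$, with the topology induced from $X\times Y$. Suppose that $Z_w$ is connected (in particular non-empty) and that the projection $\pi:Z_w\to X$, $\pi(x,y)=x$, is a local homeomorphism. Then the following conditions are equivalent: 1. $\pi$ has the continuation property for every path in $\mathcal P$: for every $p:[a,b]\to X$ in $\mathcal P$, every $c\in(a,b]$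 and every continuous $q:[a,c)\to Z_w$ with $\pi\circ q=p$ on $[a,c)$, there is a sequence $(t_n)$ in $[a,c)$ converging to $c$ such that $(q(t_n))$ converges in $Z_w$. 2. $\pi$ is proper: $\pi^{-1}(K)$ is compact for every compact $K\subseteq X$. 3. $\pi$ is a homeomorphism from $Z_w$ onto $X$. 4. There is a global implicit map for $f$ at $w$, that is, a unique map $g:X\to Y$ such that, for all $x\in X$ and $y\in Y$, $f(x,y)=w$ if and only if $y=g(x)$. -/

import Mathlib

open Filter Topology

namespace GlobalImplicit

/-- A continuous path `p : [a, b] → Y`, parametrized by an arbitrary compact interval. A family of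
paths in `Y` is a term of `Set (IntervalPath Y)`. -/
structure IntervalPath (Y : Type*) [TopologicalSpace Y] where
  a : ℝ
  b : ℝ
  a_le_b : a ≤ b
  toMap : C(Set.Icc a b, Y)

/-- The initial point `p a` of a path `p : [a, b] → Y`. -/
def IntervalPath.source {Y : Type*} [TopologicalSpace Y] (p : IntervalPath Y) : Y :=
  p.toMap ⟨p.a, Set.left_mem_Icc.2 p.a_le_b⟩

/-- The final point `p b` of a path `p : [a, b] → Y`. -/
def IntervalPath.target {Y : Type*} [TopologicalSpace Y] (p : IntervalPath Y) : Y :=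
  p.toMap ⟨p.b, Set.right_mem_Icc.2 p.a_le_b⟩

/-- The reverse path `t ↦ p (a - t + b)` on `[a, b]`. -/
def IntervalPath.reverse {Y : Type*} [TopologicalSpace Y] (p : IntervalPath Y) :
    IntervalPath Y where
  a := p.a
  b := p.b
  a_le_b := p.a_le_b
  toMap :=
    { toFun := fun t => p.toMap ⟨p.a - (t : ℝ) + p.b, by
        have h1 := t.2.1
        have h2 := t.2.2
        constructor <;> linarith⟩
      continuous_toFun := by fun_prop }

/-- `Y` is `P`-connected: `P` is closed under reversal, and any two points of `Y` are joined by a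
path that belongs to `P`. -/
def IsPathFamilyConnected {Y : Type*} [TopologicalSpace Y] (P : Set (IntervalPath Y)) : Prop :=
  (∀ p ∈ P, p.reverse ∈ P) ∧ ∀ x y : Y, ∃ p ∈ P, p.source = x ∧ p.target = y

/-- The path `t ↦ H (y, t)` on `[0, 1]`, viewed in the ambient space, for a homotopy
`H : U × [0, 1] → U`. -/
def homotopyPath {Y : Type*} [TopologicalSpace Y] {U : Set Y}
    (H : C(U × Set.Icc (0 : ℝ) 1, U)) (y : U) : IntervalPath Y where
  a := 0
  b := 1
  a_le_b := zero_le_one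
  toMap :=
    { toFun := fun t => (H (y, t) : Y)
      continuous_toFun := by fun_prop }

/-- `Y` is locally `P`-contractible: every `y₀` has an open neighborhood `U` with a homotopy
`H : U × [0, 1] → U` which fixes `y₀`, runs from the constant `y₀` to the identity of `U`, and all
of whose paths `t ↦ H (y, t)` belong to `P`. -/
def IsLocallyPathFamilyContractible {Y : Type*} [TopologicalSpace Y]
    (P : Set (IntervalPath Y)) : Prop :=
  ∀ y₀ : Y, ∃ (U : Set Y) (hy₀ : y₀ ∈ U) (H : C(U × Set.Icc (0 : ℝ) 1, U)),
    IsOpen U ∧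
    (∀ t, H (⟨y₀, hy₀⟩, t) = ⟨y₀, hy₀⟩) ∧
    (∀ y : U, H (y, ⟨0, by simp⟩) = ⟨y₀, hy₀⟩ ∧ H (y, ⟨1, by simp⟩) = y) ∧
    ∀ y : U, homotopyPath H y ∈ P

/-- `f : X → Y` has the continuation property for the path `p : [a, b] → Y`: for each `c ∈ (a, b]`
and each continuous `q : [a, c) → X` with `f ∘ q = p` on `[a, c)`, there is a sequence `t n` in
`[a, c)` converging to `c` for which `q (t n)` converges in `X`. -/
def HasContinuationProperty {X Y : Type*} [TopologicalSpace X] [TopologicalSpace Y]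
    (f : X → Y) (p : IntervalPath Y) : Prop :=
  ∀ (c : ℝ) (_ : p.a < c) (hcb : c ≤ p.b) (q : C(Set.Ico p.a c, X)),
    (∀ t : Set.Ico p.a c, f (q t) = p.toMap ⟨t, t.2.1, t.2.2.le.trans hcb⟩) →
    ∃ t : ℕ → Set.Ico p.a c,
      Tendsto (fun n => (t n : ℝ)) atTop (𝓝 c) ∧
      ∃ x : X, Tendsto (fun n => q (t n)) atTop (𝓝 x)

/-- The level set `Z_w = {(x, y) | f (x, y) = w}`. -/
def levelSet {X Y W : Type*} (f : X × Y → W) (w : W) : Set (X × Y) :=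
  {z | f z = w}

/-- The projection `π : Z_w → X`, `π (x, y) = x`. -/
def levelProj {X Y W : Type*} (f : X × Y → W) (w : W) : levelSet f w → X :=
  fun z => z.1.1

/-- There exists a global implicit map for `f` at `w`: a unique map `g : X → Y` such that
`f (x, y) = w` if and only if `y = g x`. -/
def HasGlobalImplicitMap {X Y W : Type*} (f : X × Y → W) (w : W) : Prop :=
  ∃! g : X → Y, ∀ (x : X) (y : Y), f (x, y) = w ↔ y = g x

end GlobalImplicit

/-! The substance is 1 → 3. The continuation property keeps a partial lift of a path from escaping
before its endpoint, so every path of `P` lifts from any point over its source. Lifting the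
contraction `H` of a neighbourhood from each point of the fibre gives sections; unique lifting makes
them disjoint, and lifting reversed paths shows that they exhaust the preimage. So the projection is
a covering, and connectedness of the level set with simple connectedness of `X` makes it a
homeomorphism. Homeomorphisms are proper, and sequential compactness over the image of a path gives
2 → 1. Condition 4 says that the projection is bijective, which for a local homeomorphism amounts to
3. -/

open Filter Topology

namespace GlobalImplicit

/-! ### Path lifting through local homeomorphisms -/

section Lifting

variable {E X : Type*} [TopologicalSpace E]

/-- `Γ` lifts `γ` through `π` on `[a, c]`, starting at `e`. -/
structure IsLiftOn (π : E → X) (γ : ℝ → X) (a : ℝ) (e : E) (c : ℝ) (Γ : ℝ → E) : Prop where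
  continuousOn : ContinuousOn Γ (Set.Icc a c)
  map_eq : ∀ t ∈ Set.Icc a c, π (Γ t) = γ t
  left_eq : Γ a = e

theorem IsLiftOn.mono {π : E → X} {γ : ℝ → X} {a c c' : ℝ} {e : E} {Γ : ℝ → E}
    (h : IsLiftOn π γ a e c Γ) (hc : c' ≤ c) : IsLiftOn π γ a e c' Γ :=
  ⟨h.continuousOn.mono (Set.Icc_subset_Icc_right hc),
    fun t ht => h.map_eq t ⟨ht.1, ht.2.trans hc⟩, h.left_eq⟩

variable [TopologicalSpace X]

/-- A lift on `[a, s]` ending in the domain of a local inverse of `π` extends to `[a, c]` as long as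
the path stays in the image of that domain. -/
theorem IsLiftOn.exists_extension {π : E → X} {γ : ℝ → X} (hγ : Continuous γ) {a s c : ℝ} {e : E}
    {Γ : ℝ → E} (h : IsLiftOn π γ a e s Γ) (has : a ≤ s) (φ : OpenPartialHomeomorph E X)
    (hφ : ⇑φ = π) (hs : Γ s ∈ φ.source) (hc : ∀ t ∈ Set.Icc s c, γ t ∈ φ.target) :
    ∃ Γ', IsLiftOn π γ a e c Γ' := by
  subst hφ
  refine ⟨fun t => if t ≤ s then Γ t else φ.symm (γ t), ?_, fun t ht => ?_, ?_⟩
  · refine ContinuousOn.if ?_ ?_ ?_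
    · rintro t ⟨-, ht⟩
      obtain rfl : t = s := by simpa using frontier_Iic_subset _ ht
      rw [← h.map_eq t ⟨has, le_rfl⟩, φ.left_inv hs]
    · refine h.continuousOn.mono ?_
      rintro t ⟨ht, ht'⟩
      rw [closure_le_eq continuous_id' continuous_const] at ht'
      exact ⟨ht.1, ht'⟩
    · refine φ.continuousOn_symm.comp hγ.continuousOn ?_
      rintro t ⟨ht, ht'⟩
      simp only [not_le] at ht'
      exact hc t ⟨closure_lt_subset_le continuous_const continuous_id' ht', ht.2⟩
  · by_cases hts : t ≤ s
    · simpa [hts] using h.map_eq t ⟨ht.1, hts⟩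
    · simpa [hts] using φ.right_inv (hc t ⟨(not_le.1 hts).le, ht.2⟩)
  · simpa [has] using h.left_eq

/-- Agreement of two lifts is closed since `E` is Hausdorff, open since `π` is locally injective,
and the interval is connected. -/
theorem IsLiftOn.eqOn [T2Space E] {π : E → X} (hπ : IsLocalHomeomorph π) {γ : ℝ → X} {a c : ℝ}
    {e : E} {Γ Γ' : ℝ → E} (h : IsLiftOn π γ a e c Γ) (h' : IsLiftOn π γ a e c Γ') :
    Set.EqOn Γ Γ' (Set.Icc a c) := by
  rcases le_or_gt a c with hac | hac
  · exact (T2Space.isSeparatedMap π).eqOn_of_comp_eqOn hπ.isLocallyInjective isPreconnected_Icc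
      h.continuousOn h'.continuousOn (fun t ht => (h.map_eq t ht).trans (h'.map_eq t ht).symm)
      (Set.left_mem_Icc.2 hac) (h.left_eq.trans h'.left_eq.symm)
  · simp [Set.Icc_eq_empty_of_lt hac]

/-- A continuous extension of a path to the real line. -/
noncomputable def IntervalPath.extend (p : IntervalPath X) : ℝ → X := Set.IccExtend p.a_le_b p.toMap

theorem IntervalPath.continuous_extend (p : IntervalPath X) : Continuous p.extend :=
  p.toMap.continuous.Icc_extend'

theorem IntervalPath.extend_of_mem (p : IntervalPath X) {t : ℝ} (ht : t ∈ Set.Icc p.a p.b) :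
    p.extend t = p.toMap ⟨t, ht⟩ :=
  Set.IccExtend_of_mem _ _ ht

/-- If `p` lifts to each `[a, s]` with `s < c`, the continuation property lifts it to `[a, c]`. -/
theorem exists_isLiftOn_of_forall_lt [T2Space E] [T2Space X] {π : E → X}
    (hπ : IsLocalHomeomorph π) {p : IntervalPath X} (hp : HasContinuationProperty π p) {e : E}
    {c : ℝ} (hac : p.a < c) (hcb : c ≤ p.b)
    (h : ∀ s < c, ∃ Γ, IsLiftOn π p.extend p.a e s Γ) :
    ∃ Γ, IsLiftOn π p.extend p.a e c Γ := by
  choose Γ hΓ using h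
  -- Diagonal choice: the value at `t` comes from the lift on `[a, t]`. Uniqueness makes it agree
  -- with every longer lift, whence continuity.
  let q : Set.Ico p.a c → E := fun t => Γ t t.2.2 t
  have hq : ∀ (s : ℝ) (hs : s < c) (t : Set.Ico p.a c), (t : ℝ) ≤ s → q t = Γ s hs t :=
    fun s hs t hts => (hΓ t t.2.2).eqOn hπ ((hΓ s hs).mono hts) ⟨t.2.1, le_rfl⟩
  have hqc : Continuous q := by
    refine continuous_iff_continuousAt.2 fun t => ?_
    obtain ⟨s, hts, hsc⟩ := exists_between t.2.2
    have hmem : Subtype.val ⁻¹' Set.Iio s ∈ 𝓝 t :=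
      (isOpen_Iio.preimage continuous_subtype_val).mem_nhds hts
    have hon : ContinuousOn (fun u : Set.Ico p.a c => Γ s hsc u) (Subtype.val ⁻¹' Set.Iio s) :=
      (hΓ s hsc).continuousOn.comp continuous_subtype_val.continuousOn
        fun u hu => ⟨u.2.1, le_of_lt hu⟩
    exact (hon.continuousAt hmem).congr
      (mem_of_superset hmem fun u hu => (hq s hsc u (le_of_lt hu)).symm)
  have hqπ : ∀ t, π (q t) = p.extend t := fun t => (hΓ t t.2.2).map_eq t ⟨t.2.1, le_rfl⟩
  obtain ⟨t, ht, x, hx⟩ := hp c hac hcb ⟨q, hqc⟩ fun t =>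
    (hqπ t).trans (p.extend_of_mem ⟨t.2.1, t.2.2.le.trans hcb⟩)
  obtain ⟨φ, hxφ, rfl⟩ := hπ x
  have hxc : φ x = p.extend c := by
    refine tendsto_nhds_unique (hπ.continuous.continuousAt.tendsto.comp hx) ?_
    simpa only [Function.comp_def, ContinuousMap.coe_mk, hqπ] using
      (p.continuous_extend.tendsto c).comp ht
  have htarget : p.extend ⁻¹' φ.target ∈ 𝓝 c :=
    (φ.open_target.preimage p.continuous_extend).mem_nhds (by
      rw [Set.mem_preimage, ← hxc]; exact φ.map_source hxφ)
  obtain ⟨l, u, hlu, hsub⟩ := mem_nhds_iff_exists_Ioo_subset.1 htarget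
  -- Choose `n` with `q (t n)` in the chart around the limit and `t n` so near `c` that the path
  -- stays in the chart's target on `[t n, c]`.
  obtain ⟨n, hn, hln⟩ := ((hx.eventually (φ.open_source.mem_nhds hxφ)).and
    (ht.eventually (lt_mem_nhds hlu.1))).exists
  exact (hΓ (t n) (t n).2.2).exists_extension p.continuous_extend (t n).2.1 φ rfl hn
    fun s hs => hsub ⟨hln.trans_le hs.1, hs.2.trans_lt hlu.2⟩

/-- The supremum of the times up to which `p` lifts is attained by the continuation property
(trivially if it is `p.a`); were it less than `p.b`, a chart at the end of the lift would extend it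
further. -/
theorem exists_isLiftOn [T2Space E] [T2Space X] {π : E → X}
    (hπ : IsLocalHomeomorph π) {p : IntervalPath X} (hp : HasContinuationProperty π p) {e : E}
    (he : π e = p.source) : ∃ Γ, IsLiftOn π p.extend p.a e p.b Γ := by
  let S : Set ℝ := {c | c ∈ Set.Icc p.a p.b ∧ ∃ Γ, IsLiftOn π p.extend p.a e c Γ}
  have haS : p.a ∈ S := by
    refine ⟨Set.left_mem_Icc.2 p.a_le_b, fun _ => e, continuousOn_const, fun t ht => ?_, rfl⟩
    obtain rfl : t = p.a := by simpa using ht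
    exact he.trans (p.extend_of_mem (Set.left_mem_Icc.2 p.a_le_b)).symm
  have hbdd : BddAbove S := ⟨p.b, fun c hc => hc.1.2⟩
  have hac : p.a ≤ sSup S := le_csSup hbdd haS
  have hcb : sSup S ≤ p.b := csSup_le ⟨_, haS⟩ fun c hc => hc.1.2
  obtain ⟨Γ, hΓ⟩ : ∃ Γ, IsLiftOn π p.extend p.a e (sSup S) Γ := by
    rcases hac.eq_or_lt with hac | hac
    · exact hac ▸ haS.2
    · refine exists_isLiftOn_of_forall_lt hπ hp hac hcb fun s hs => ?_
      obtain ⟨c, ⟨-, Γ, hΓ⟩, hsc⟩ := exists_lt_of_lt_csSup ⟨_, haS⟩ hs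
      exact ⟨Γ, hΓ.mono hsc.le⟩
  rcases hcb.eq_or_lt with hcb | hcb
  · exact ⟨Γ, hcb ▸ hΓ⟩
  obtain ⟨φ, hφ, hφπ⟩ := hπ (Γ (sSup S))
  have htarget : p.extend ⁻¹' φ.target ∈ 𝓝 (sSup S) :=
    (φ.open_target.preimage p.continuous_extend).mem_nhds (by
      rw [Set.mem_preimage, ← hΓ.map_eq _ ⟨hac, le_rfl⟩, hφπ]; exact φ.map_source hφ)
  obtain ⟨l, u, hlu, hsub⟩ := mem_nhds_iff_exists_Ioo_subset.1 htarget
  obtain ⟨c, hc, hcu⟩ := exists_between (lt_min hlu.2 hcb)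
  have hcS : c ∈ S := ⟨⟨hac.trans hc.le, (hcu.trans_le (min_le_right _ _)).le⟩,
    hΓ.exists_extension p.continuous_extend hac φ hφπ.symm hφ
      fun s hs => hsub ⟨hlu.1.trans_le hs.1, hs.2.trans_lt (hcu.trans_le (min_le_left _ _))⟩⟩
  exact absurd (le_csSup hbdd hcS) hc.not_ge

/-- Paths with the continuation property lift through local homeomorphisms. -/
theorem exists_lift_of_hasContinuationProperty [T2Space E] [T2Space X] {π : E → X}
    (hπ : IsLocalHomeomorph π) {p : IntervalPath X} (hp : HasContinuationProperty π p) {e : E}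
    (he : π e = p.source) :
    ∃ Γ : C(Set.Icc p.a p.b, E), (∀ t, π (Γ t) = p.toMap t) ∧
      Γ ⟨p.a, Set.left_mem_Icc.2 p.a_le_b⟩ = e := by
  obtain ⟨Γ, hΓ⟩ := exists_isLiftOn hπ hp he
  exact ⟨⟨fun t => Γ t, hΓ.continuousOn.comp_continuous continuous_subtype_val fun t => t.2⟩,
    fun t => (hΓ.map_eq t t.2).trans (p.extend_of_mem t.2), hΓ.left_eq⟩

end Lifting

/-! ### From contractions to coverings and homeomorphisms -/

section Covering

variable {E X : Type*} [TopologicalSpace E] [TopologicalSpace X]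

/-- Since `H` fixes `x` at all times, the tube lemma gives a neighbourhood of `x` whose tracks under
`H` stay in `V`; these tracks join `x` to its points. -/
theorem IsLocallyPathFamilyContractible.locallyPathConnectedSpace {P : Set (IntervalPath X)}
    (hP : IsLocallyPathFamilyContractible P) : LocallyPathConnectedSpace X := by
  rw [locallyPathConnectedSpace_iff_pathComponentIn_mem_nhds]
  intro x V hV hxV
  obtain ⟨U, hxU, H, hU, hfix, hH, -⟩ := hP x
  have hopen : IsOpen {z : U × Set.Icc (0 : ℝ) 1 | (H z : X) ∈ V} :=
    hV.preimage (continuous_subtype_val.comp H.continuous)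
  obtain ⟨N, M, hN, -, hxN, hM, hNM⟩ := generalized_tube_lemma
    (isCompact_singleton (x := (⟨x, hxU⟩ : U))) (isCompact_univ (X := Set.Icc (0 : ℝ) 1)) hopen (by
      rintro ⟨y, t⟩ ⟨hy, -⟩
      obtain rfl : y = ⟨x, hxU⟩ := hy
      simpa [hfix] using hxV)
  refine mem_of_superset ((hU.isOpenMap_subtype_val N hN).mem_nhds ⟨_, hxN rfl, rfl⟩) ?_
  rintro _ ⟨y, hy, rfl⟩
  exact ⟨⟨⟨fun t => H (y, t), by fun_prop⟩, congrArg Subtype.val (hH y).1,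
    congrArg Subtype.val (hH y).2⟩, fun t => hNM (Set.mk_mem_prod hy (hM trivial))⟩

/-- The homotopy of a contractible neighbourhood lifts to a section through each point of the
fibre. -/
theorem exists_local_section [T2Space E] [T2Space X] {π : E → X} (hπ : IsLocalHomeomorph π)
    {U : Set X} {x : X} (hxU : x ∈ U) {H : C(U × Set.Icc (0 : ℝ) 1, U)}
    (hH : ∀ y : U, H (y, ⟨0, by simp⟩) = ⟨x, hxU⟩ ∧ H (y, ⟨1, by simp⟩) = y)
    (hcont : ∀ y : U, HasContinuationProperty π (homotopyPath H y)) {e : E} (he : π e = x) :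
    ∃ σ : C(U, E), (∀ y : U, π (σ y) = y) ∧
      ∀ y : U, ∃ Γ : C(unitInterval, E),
        (∀ t, π (Γ t) = H (y, t)) ∧ Γ 0 = e ∧ Γ 1 = σ y := by
  have hlift : ∀ y : U, ∃ Γ : C(unitInterval, E), (∀ t, π (Γ t) = H (y, t)) ∧ Γ 0 = e :=
    fun y => exists_lift_of_hasContinuationProperty hπ (hcont y)
      (he.trans (congrArg Subtype.val (hH y).1).symm)
  choose Γ hΓ hΓ0 using hlift
  -- Joint continuity follows from continuity of each lift in time and of the starting points, here
  -- constantly `e`.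
  have hc : Continuous fun z : unitInterval × U => Γ z.2 z.1 :=
    hπ.continuous_lift (T2Space.isSeparatedMap π)
      ⟨fun z : unitInterval × U => (H (z.2, z.1) : X), by fun_prop⟩
      (funext fun z => hΓ z.2 z.1) (by simpa only [hΓ0] using continuous_const)
      fun y => (Γ y).continuous
  exact ⟨⟨fun y => Γ y 1, hc.comp (Continuous.prodMk_right 1)⟩,
    fun y => (hΓ y 1).trans (congrArg Subtype.val (hH y).2),
    fun y => ⟨Γ y, hΓ y, hΓ0 y, rfl⟩⟩

/-- A local homeomorphism is evenly covered over an open set whose preimage is partitioned by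
sections. -/
theorem isEvenlyCovered_of_sections {π : E → X} (hπ : IsLocalHomeomorph π) {U : Set X}
    (hU : IsOpen U) {x : X} (hxU : x ∈ U) (σ : π ⁻¹' {x} → C(U, E))
    (hσ : ∀ i y, π (σ i y) = y) (hinj : ∀ i j y, σ i y = σ j y → i = j)
    (hsurj : ∀ z, ∀ hz : π z ∈ U, ∃ i, σ i ⟨π z, hz⟩ = z) :
    IsEvenlyCovered π x (π ⁻¹' {x}) := by
  -- The fibre has a one-point image under a local homeomorphism, so it is discrete and continuity
  -- of `G` can be checked sheet by sheet.
  have hsub : (π '' (π ⁻¹' {x})).Subsingleton :=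
    Set.subsingleton_singleton.anti (Set.image_preimage_subset _ _)
  have := hsub.coe_sort
  have hdisc : DiscreteTopology (π ⁻¹' {x}) :=
    (hπ.isLocalHomeomorphOn.mono (Set.subset_univ _)).discreteTopology_of_image
  let G : U × π ⁻¹' {x} → π ⁻¹' U := fun z => ⟨σ z.2 z.1, by
    rw [Set.mem_preimage, hσ]; exact z.1.2⟩
  have hGc : Continuous G :=
    (continuous_prod_of_discrete_right.2 fun i => (σ i).continuous).subtype_mk _
  have hσo : ∀ i, IsOpenMap (σ i) := fun i =>
    (hπ.isOpenEmbedding_of_comp (f := σ i) (by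
      rw [show π ∘ σ i = Subtype.val from funext (hσ i)]
      exact hU.isOpenEmbedding_subtypeVal) (σ i).continuous).isOpenMap
  have hGo : IsOpenMap G := by
    intro O hO
    have hGO : G '' O = Subtype.val ⁻¹' ⋃ i, σ i '' ((fun y => (y, i)) ⁻¹' O) := by
      ext z
      simp only [Set.mem_image, Set.mem_preimage, Set.mem_iUnion, Prod.exists, G, Subtype.ext_iff]
      exact exists_comm
    rw [hGO]
    exact (isOpen_iUnion fun i => hσo i _ (hO.preimage (by fun_prop))).preimage
      continuous_subtype_val
  have hGb : Function.Bijective G := by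
    refine ⟨fun ⟨y, i⟩ ⟨y', j⟩ h => ?_, fun z => ?_⟩
    · have h' : σ i y = σ j y' := congrArg Subtype.val h
      obtain rfl : y = y' := Subtype.ext (by rw [← hσ i y, ← hσ j y', h'])
      rw [hinj i j y h']
    · obtain ⟨i, hi⟩ := hsurj z z.2
      exact ⟨(⟨π z, z.2⟩, i), Subtype.ext hi⟩
  let e := (Equiv.ofBijective G hGb).toHomeomorphOfContinuousOpen hGc hGo
  refine ⟨hdisc, U, hxU, hU, hU.preimage hπ.continuous, e.symm, fun z => ?_⟩
  obtain ⟨y, rfl⟩ := e.surjective z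
  rw [e.symm_apply_apply]
  exact (hσ y.2 y.1).symm

theorem homotopyPath_reverse_apply {U : Set X} (H : C(U × Set.Icc (0 : ℝ) 1, U)) (y : U)
    (t : unitInterval) :
    (homotopyPath H y).reverse.toMap t = H (y, unitInterval.symm t) := by
  refine congrArg (fun s : unitInterval => (H (y, s) : X)) (Subtype.ext ?_)
  change (0 : ℝ) - t + 1 = 1 - t
  ring

/-- A local homeomorphism with the continuation property along a contracting family of paths is a
covering map. -/
theorem isCoveringMap_of_hasContinuationProperty [T2Space E] [T2Space X] {π : E → X}
    (hπ : IsLocalHomeomorph π) {P : Set (IntervalPath X)} (hrev : ∀ p ∈ P, p.reverse ∈ P)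
    (hP : IsLocallyPathFamilyContractible P) (hcont : ∀ p ∈ P, HasContinuationProperty π p) :
    IsCoveringMap π := by
  intro x
  obtain ⟨U, hxU, H, hU, -, hH, hHP⟩ := hP x
  choose σ hσ hσΓ using fun i : π ⁻¹' {x} =>
    exists_local_section hπ hxU hH (fun y => hcont _ (hHP y)) i.2
  have sep := T2Space.isSeparatedMap π
  have inj := hπ.isLocallyInjective
  refine isEvenlyCovered_of_sections hπ hU hxU σ hσ (fun i j y hij => ?_) fun z hz => ?_
  · obtain ⟨Γ, hΓ, hΓ0, hΓ1⟩ := hσΓ i y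
    obtain ⟨Γ', hΓ', hΓ0', hΓ1'⟩ := hσΓ j y
    have := sep.eq_of_comp_eq inj Γ.continuous Γ'.continuous
      (funext fun t => (hΓ t).trans (hΓ' t).symm) 1 (by rw [hΓ1, hΓ1', hij])
    exact Subtype.ext (by rw [← hΓ0, ← hΓ0', this])
  -- The reversed track lifted from `z` ends in the fibre over `x`. Run backwards, it is the lift
  -- defining the section through that endpoint, which therefore hits `z`.
  · obtain ⟨Δ, hΔ, hΔ0⟩ : ∃ Δ : C(unitInterval, E),
        (∀ t, π (Δ t) = H (⟨π z, hz⟩, unitInterval.symm t)) ∧ Δ 0 = z := by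
      obtain ⟨Δ, hΔ, hΔ0⟩ := exists_lift_of_hasContinuationProperty hπ
        (hcont _ (hrev _ (hHP ⟨π z, hz⟩))) (e := z) (by
          refine (congrArg Subtype.val (hH ⟨π z, hz⟩).2).symm.trans ?_
          refine Eq.trans ?_ (homotopyPath_reverse_apply H ⟨π z, hz⟩ 0).symm
          rw [unitInterval.symm_zero]
          rfl)
      exact ⟨Δ, fun t => (hΔ t).trans (homotopyPath_reverse_apply H _ t), hΔ0⟩
    have hi : π (Δ 1) = x := by
      rw [hΔ, unitInterval.symm_one]
      exact congrArg Subtype.val (hH _).1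
    refine ⟨⟨Δ 1, hi⟩, ?_⟩
    obtain ⟨Γ, hΓ, hΓ0, hΓ1⟩ := hσΓ ⟨Δ 1, hi⟩ ⟨π z, hz⟩
    have := sep.eq_of_comp_eq inj Γ.continuous (Δ.continuous.comp unitInterval.continuous_symm)
      (funext fun t => (hΓ t).trans (by simp [hΔ])) 0 (by simp [hΓ0])
    rw [← hΓ1, this]
    simpa using hΔ0

/-- A covering map from a connected space onto a simply connected and locally path-connected space
is a homeomorphism. -/
theorem isHomeomorph_of_isCoveringMap [SimplyConnectedSpace X] [LocallyPathConnectedSpace X]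
    [ConnectedSpace E] [T2Space E] {π : E → X} (hπ : IsCoveringMap π) : IsHomeomorph π := by
  obtain ⟨e⟩ : Nonempty E := inferInstance
  -- Lifting the identity gives a global section `s`; its range is open and closed, hence all of the
  -- connected space `E`.
  obtain ⟨s, ⟨hse, hs⟩, -⟩ := hπ.existsUnique_continuousMap_lifts (.id X) (π e) e rfl
  have hs' : ∀ x, π (s x) = x := congrFun hs
  have hrange : Set.range s = {z | s (π z) = z} :=
    Set.ext fun z => ⟨by rintro ⟨x, rfl⟩; simp [hs'], fun h => ⟨_, h⟩⟩
  have hopen : IsOpen (Set.range s) :=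
    (hπ.isLocalHomeomorph.isOpenEmbedding_of_comp (f := s)
      (by rw [hs]; exact .id) s.continuous).isOpen_range
  have hclosed : IsClosed (Set.range s) := by
    rw [hrange]
    exact isClosed_eq (s.continuous.comp hπ.continuous) continuous_id
  have huniv := IsClopen.eq_univ ⟨hclosed, hopen⟩ ⟨_, Set.mem_range_self (π e)⟩
  have hleft : ∀ z, s (π z) = z := Set.eq_univ_iff_forall.1 (hrange.symm.trans huniv)
  exact ⟨hπ.continuous, hπ.isOpenMap, Function.LeftInverse.injective hleft,
    Function.RightInverse.surjective hs'⟩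

end Covering

/-- Maps into a metrizable space for which preimages of compact sets are compact have the
continuation property along every path. -/
theorem hasContinuationProperty_of_isCompact_preimage {E X : Type*} [MetricSpace E]
    [TopologicalSpace X] {π : E → X} (h : ∀ K : Set X, IsCompact K → IsCompact (π ⁻¹' K))
    (p : IntervalPath X) : HasContinuationProperty π p := by
  intro c hac hcb q hq
  obtain ⟨u, -, hu, huc⟩ := exists_seq_strictMono_tendsto' hac
  obtain ⟨x, -, ψ, hψ, hx⟩ := (h _ (isCompact_range p.toMap.continuous)).tendsto_subseq
    (x := fun n => q ⟨u n, (hu n).1.le, (hu n).2⟩) fun n => ⟨_, (hq _).symm⟩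
  exact ⟨fun n => ⟨u (ψ n), (hu _).1.le, (hu _).2⟩, huc.comp hψ.tendsto_atTop, x, hx⟩

/-- The fibre of the projection over `x` is a copy of the solution set of `f (x, y) = w` in `y`. -/
theorem hasGlobalImplicitMap_iff_bijective {X Y W : Type*} {f : X × Y → W} {w : W} :
    HasGlobalImplicitMap f w ↔ Function.Bijective (levelProj f w) := by
  constructor
  · rintro ⟨g, hg, -⟩
    refine ⟨fun ⟨⟨x, y⟩, hz⟩ ⟨⟨x', y'⟩, hz'⟩ h => ?_, fun x => ⟨⟨(x, g x), (hg _ _).2 rfl⟩, rfl⟩⟩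
    obtain rfl : x = x' := h
    obtain rfl : y = y' := ((hg _ _).1 hz).trans ((hg _ _).1 hz').symm
    rfl
  · intro h
    choose s hs using h.2
    have hg : ∀ x y, f (x, y) = w ↔ y = (s x).1.2 := by
      refine fun x y => ⟨fun hxy => ?_, ?_⟩
      · let z : levelSet f w := ⟨(x, y), hxy⟩
        have hz : s x = z := h.1 (hs x)
        rw [hz]
      · rintro rfl
        have hsx : (s x).1 = (x, (s x).1.2) := Prod.ext (hs x) rfl
        exact hsx ▸ (s x).2
    exact ⟨fun x => (s x).1.2, hg, fun g hg' => funext fun x => (hg x _).1 ((hg' x _).2 rfl)⟩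

end GlobalImplicit

theorem mainTheorem11 {X Y W : Type*} [MetricSpace X] [MetricSpace Y] [MetricSpace W]
    [SimplyConnectedSpace X]
    (P : Set (GlobalImplicit.IntervalPath X))
    (hPconn : GlobalImplicit.IsPathFamilyConnected P)
    (hPcontr : GlobalImplicit.IsLocallyPathFamilyContractible P)
    (f : X × Y → W) (hf : Continuous f) (w : W)
    (hZ : IsConnected (GlobalImplicit.levelSet f w))
    (hπ : IsLocalHomeomorph (GlobalImplicit.levelProj f w)) :
    List.TFAE [
      ∀ p ∈ P, GlobalImplicit.HasContinuationProperty (GlobalImplicit.levelProj f w) p,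
      ∀ K : Set X, IsCompact K → IsCompact (GlobalImplicit.levelProj f w ⁻¹' K),
      IsHomeomorph (GlobalImplicit.levelProj f w),
      GlobalImplicit.HasGlobalImplicitMap f w] := by
  tfae_have 1 → 3 := by
    intro h
    have := hPcontr.locallyPathConnectedSpace
    have := isConnected_iff_connectedSpace.1 hZ
    exact GlobalImplicit.isHomeomorph_of_isCoveringMap
      (GlobalImplicit.isCoveringMap_of_hasContinuationProperty hπ hPconn.1 hPcontr h)
  tfae_have 3 → 2 := fun h K hK => h.homeomorph.isClosedEmbedding.isCompact_preimage hK
  tfae_have 2 → 1 := fun h p _ => GlobalImplicit.hasContinuationProperty_of_isCompact_preimage h p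
  tfae_have 3 ↔ 4 := by
    rw [GlobalImplicit.hasGlobalImplicitMap_iff_bijective]
    exact ⟨fun h => h.bijective, fun h => ⟨hπ.continuous, hπ.isOpenMap, h⟩⟩
  tfae_finish
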